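/- Graphs are finite and simple. For a graph $G$ with adjacency matrix $A(G)$ and diagonal degree matrix $D(G)$ and for $\alpha\in[0,1)$ put $A_\alpha(G)=\alpha D(G)+(1-\alpha)A(G)$, and let $\rho(A_\alpha(G))$ be its spectral radius. A graph is unicyclic if it is connected and contains exactly one cycle. For a sequence $\pi=(d_0,\dots,d_{n-1})$ let $\mathcal G_\pi$ be the class of connected graphs of order $n$ with degree sequence $\pi$; call $\pi$ unicyclic graphic if $\mathcal G_\pi$ contains a unicyclic graph. For a nonincreasing unicyclic graphic sequence $\pi$ with $n\ge 3$ let $\mathcal U^*_\pi$ be the following graph. - If $d_0=2$, then $\mathcal U^*_\pi$ is the cycle $C_n$. - If $d_0\ge 3$ and $d_1=2$, then $\mathcal U^*_\pi$ is a triangle with $d_0-2$ hanging paths attached at one and the same vertex of it, whose lengths pairwise differ by at most one (and which have $n-3$ vertices outside the triangle altogether). - If $d_1\ge 3$, then $\mathcal U^*_\pi$ is built by breadth-first search, its vertices being numbered $0,1,\dots,n-1$ layer by layer and from left to right in each layer, with vertex $i$ of degree $d_i$: the root $0$ is adjacent to the vertices $1,\dots,d_0$ of the first layer; the vertices $1$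 and $2$ are adjacent; and then, for $i=1,2,3,\dots$ in turn, vertex $i$ is joined to the next $c_i$ vertices not yet used, in the next layer, where $c_1=d_1-2$, $c_2=d_2-2$ and $c_i=d_i-1$ for $i\ge 3$. **Theorem.** Let $n\ge 3$ and let $\pi=(d_0,d_1,\dots,d_{n-1})$ be a nonincreasing sequence of positive integers with $\sum_{i=0}^{n-1}d_i=2n$. Then $\pi$ is unicyclic graphic if and only if $d_2\ge 2$. If $\pi$ is unicyclic graphic, then $\mathcal U^*_\pi$ is a unicyclic graph in $\mathcal G_\pi$, and for every $0\le\alpha<1$ $$\rho(A_\alpha(\mathcal U^*_\pi))=\max\{\rho(A_\alpha(H)) : H \text{ is unicyclic and } H\in\mathcal G_\pi\}.$$ -/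

import Mathlib

open scoped ENNReal

noncomputable section

/-- The matrix `A_α(G) = α D(G) + (1 - α) A(G)`, where `D(G)` is the diagonal matrix of the
degrees and `A(G)` is the adjacency matrix of `G`. -/
def aAlphaMatrix {V : Type*} [Fintype V] [DecidableEq V] (α : ℝ) (G : SimpleGraph V) :
    Matrix V V ℝ := by
  classical
  exact α • G.degMatrix ℝ + (1 - α) • G.adjMatrix ℝ

/-- The `A_α`-spectral radius of `G`: the largest absolute value of an eigenvalue of the real
symmetric matrix `A_α(G)` (all of its complex eigenvalues are real). -/
def aAlphaSpectralRadius {V : Type*} [Fintype V] [DecidableEq V] (α : ℝ) (G : SimpleGraph V) :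
    ℝ≥0∞ :=
  spectralRadius ℝ (aAlphaMatrix α G)

/-- `G` has `d = (d_0, …, d_{n-1})` as its degree sequence: its vertices can be enumerated so
that the `i`-th one has degree `d_i`. -/
def HasDegreeSequence {V : Type*} [Fintype V] {n : ℕ} (G : SimpleGraph V) (d : Fin n → ℕ) :
    Prop := by
  classical
  exact ∃ e : Fin n ≃ V, ∀ i, G.degree (e i) = d i

/-- A unicyclic graph: a connected graph that contains exactly one cycle (as a subgraph). -/
def IsUnicyclic {V : Type*} (G : SimpleGraph V) : Prop :=
  G.Connected ∧ ∃! C : G.Subgraph, ∃ (v : V) (p : G.Walk v v), p.IsCycle ∧ p.toSubgraph = C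

/-- The class `𝒢_d` of the connected graphs on `n` vertices with degree sequence `d`. -/
def connectedClass {n : ℕ} (d : Fin n → ℕ) : Set (SimpleGraph (Fin n)) :=
  {G | G.Connected ∧ HasDegreeSequence G d}

/-- `d` is unicyclic graphic: it is the degree sequence of some unicyclic graph. -/
def IsUnicyclicGraphic {n : ℕ} (d : Fin n → ℕ) : Prop :=
  ∃ G ∈ connectedClass d, IsUnicyclic G

/-- The triangle `0, 1, 2` with `k` hanging paths attached at its vertex `0`, whose lengths are
almost equal. For `0 ≤ r < k` the `r`-th path is `0, 3 + r, 3 + r + k, 3 + r + 2k, …`, continued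
as long as there are vertices; so two of the lengths differ by at most one. -/
def triangleWithPaths (n k : ℕ) : SimpleGraph (Fin n) :=
  SimpleGraph.fromRel fun i j =>
    (i.val = 0 ∧ j.val < 3 + k) ∨ (i.val = 1 ∧ j.val = 2) ∨ (3 ≤ i.val ∧ j.val = i.val + k)

/-- The number of neighbours that the vertex number `i` receives in the next layer in the
breadth-first construction: the root `0` receives `d_0`, the first two vertices `1` and `2` of
the first layer (which are adjacent to each other) receive `d_i - 2`, and every other vertex
receives `d_i - 1`. -/
def bfsChildren {n : ℕ} (d : Fin n → ℕ) (i : Fin n) : ℕ :=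
  if i.val = 0 then d i else if i.val ≤ 2 then d i - 2 else d i - 1

/-- The breadth-first-search graph of the degree sequence `d`. The vertices are numbered
`0, 1, …, n - 1` layer by layer, from left to right in each layer. The vertices of the next layer
are distributed among those of the present one from left to right, so that the vertices
`0, …, i - 1` together have the children `1, …, S`, with `S` the sum of their numbers of
children, and the children of `i` are the next `bfsChildren d i` vertices
`S + 1, …, S + bfsChildren d i`. Besides, the vertices `1` and `2` are adjacent. -/
def bfsUnicyclic {n : ℕ} (d : Fin n → ℕ) : SimpleGraph (Fin n) :=
  SimpleGraph.fromRel fun i j =>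
    ((∑ k ∈ Finset.Iio i, bfsChildren d k) < j.val ∧
      j.val ≤ (∑ k ∈ Finset.Iio i, bfsChildren d k) + bfsChildren d i) ∨
    (i.val = 1 ∧ j.val = 2)

/-- The graph `𝒰*_d` for the degree sequence `d_0 ≥ d_1 ≥ … ≥ d_{n-1}` of a unicyclic graph: the
cycle `C_n` if `d_0 = 2`; the triangle with `d_0 - 2` almost equal hanging paths at one vertex if
`d_0 ≥ 3` and `d_1 = 2`; the breadth-first-search graph if `d_1 ≥ 3`. -/
def uStar {n : ℕ} (hn : 3 ≤ n) (d : Fin n → ℕ) : SimpleGraph (Fin n) :=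
  if d ⟨0, by omega⟩ = 2 then SimpleGraph.cycleGraph n
  else if d ⟨1, by omega⟩ = 2 then triangleWithPaths n (d ⟨0, by omega⟩ - 2)
  else bfsUnicyclic d

end

/-! For every nonnegative vector, suitably sorted, the breadth-first graph maximizes the quadratic
form of `A_α`; no Perron vector and no switching of edges is needed. Relabel the vertices of a
competitor `G` so that `x` is nonincreasing. The degree term is then bounded by the rearrangement
inequality. Abel summation in both variables writes the adjacency term as a combination, with
nonnegative coefficients, of the numbers `prefixPairs G k l`, so it suffices that the breadth-first
graph maximizes all these numbers at once.

For k ≤ l a connected graph with n edges obeys two bounds: the sum of the k largest degrees, and k +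
l (less for small k, l), because no nonempty vertex set spans more edges than it has elements
(`SimpleGraph.Connected.sum_adj_le`). The breadth-first graph reaches the smaller of the two
(`le_prefixPairs_bfsUnicyclic`): either all children of the first k vertices lie below l, or every
vertex below l other than the root has its parent below k.

Since `A_α` is symmetric and entrywise nonnegative, forms on nonnegative vectors control the
spectral radius. If d_0 ≥ 3, `uStar` is the breadth-first graph, even when d_1 = 2; if d_0 = 2,
every competitor is 2-regular and has radius 2. A count of edges gives d_2 ≥ 2; conversely this
inequality makes the construction work, and a connected graph with n edges is unicyclic. -/

open Finset

/-! ### Quadratic forms and the spectral radius -/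

/-- The quadratic form of `A_α(G)`, the neighbours being counted through indicators. -/
theorem aAlphaMatrix_quadForm {n : ℕ} (α : ℝ) (G : SimpleGraph (Fin n)) [DecidableRel G.Adj]
    (x : Fin n → ℝ) :
    x ⬝ᵥ (aAlphaMatrix α G).mulVec x =
      α * ∑ i, (G.degree i : ℝ) * x i ^ 2 +
        (1 - α) * ∑ i, x i * ∑ j, x j * (if G.Adj i j then 1 else 0) := by
  classical
  have h : aAlphaMatrix α G = α • G.degMatrix ℝ + (1 - α) • G.adjMatrix ℝ := by
    unfold aAlphaMatrix
    convert rfl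
  rw [h, Matrix.add_mulVec, dotProduct_add, Matrix.smul_mulVec, Matrix.smul_mulVec,
    dotProduct_smul, dotProduct_smul, smul_eq_mul, smul_eq_mul]
  congr 2
  · simp only [dotProduct, SimpleGraph.degMatrix, Matrix.mulVec_diagonal]
    exact sum_congr rfl fun i _ => by ring
  · simp only [dotProduct, Matrix.mulVec, SimpleGraph.adjMatrix_apply]
    exact sum_congr rfl fun i _ => by
      congr 1
      exact sum_congr rfl fun j _ => by ring

theorem aAlphaMatrix_isHermitian {n : ℕ} (α : ℝ) (G : SimpleGraph (Fin n)) :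
    (aAlphaMatrix α G).IsHermitian := by
  classical
  unfold aAlphaMatrix
  ext i j
  simp [SimpleGraph.degMatrix, Matrix.diagonal_apply, SimpleGraph.adj_comm, eq_comm]
  split_ifs with h
  · rw [h]
  · rfl

theorem aAlphaMatrix_nonneg {n : ℕ} {α : ℝ} (h0 : 0 ≤ α) (h1 : α < 1)
    (G : SimpleGraph (Fin n)) (i j : Fin n) : 0 ≤ aAlphaMatrix α G i j := by
  classical
  unfold aAlphaMatrix
  simp only [Matrix.add_apply, Matrix.smul_apply, smul_eq_mul, SimpleGraph.degMatrix,
    Matrix.diagonal_apply, SimpleGraph.adjMatrix_apply]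
  have : 0 ≤ 1 - α := by linarith
  positivity

/-- The quadratic form of a symmetric matrix is bounded by its spectral radius. -/
theorem Matrix.IsHermitian.quadForm_le_spectralRadius {n : ℕ} {A : Matrix (Fin n) (Fin n) ℝ}
    (hA : A.IsHermitian) {r : ℝ} (hr : 0 ≤ r) (h : spectralRadius ℝ A ≤ ENNReal.ofReal r)
    (x : Fin n → ℝ) : x ⬝ᵥ A.mulVec x ≤ r * (x ⬝ᵥ x) := by
  have hpsd : (algebraMap ℝ (Matrix (Fin n) (Fin n) ℝ) r - A).PosSemidef := by
    rw [Matrix.posSemidef_iff_isHermitian_and_spectrum_nonneg]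
    refine ⟨?_, ?_⟩
    · refine Matrix.IsHermitian.sub ?_ hA
      rw [Algebra.algebraMap_eq_smul_one]
      simp [Matrix.IsHermitian]
    · rw [← spectrum.singleton_sub_eq]
      rintro _ ⟨_, hr', t, ht, rfl⟩
      rw [Set.mem_singleton_iff.1 hr']
      have h1 : (‖t‖₊ : ENNReal) ≤ ENNReal.ofReal r :=
        (le_iSup₂ (f := fun k (_ : k ∈ spectrum ℝ A) => (‖k‖₊ : ENNReal)) t ht).trans h
      have h2 : ‖t‖ ≤ r := by
        rw [← ENNReal.ofReal_le_ofReal_iff hr, ofReal_norm]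
        exact h1
      have := (le_abs_self t).trans h2
      simpa using this
  have := hpsd.dotProduct_mulVec_nonneg x
  rw [Algebra.algebraMap_eq_smul_one, Matrix.sub_mulVec, dotProduct_sub, Matrix.smul_mulVec,
    Matrix.one_mulVec, dotProduct_smul] at this
  simpa using this

/-- A bound of the quadratic form of a nonnegative matrix on nonnegative vectors bounds its
spectral radius. -/
theorem Matrix.spectralRadius_le_of_quadForm_le {n : ℕ} {A : Matrix (Fin n) (Fin n) ℝ}
    (hA : ∀ i j, 0 ≤ A i j) {r : ℝ}
    (h : ∀ x : Fin n → ℝ, (∀ i, 0 ≤ x i) → x ⬝ᵥ A.mulVec x ≤ r * (x ⬝ᵥ x)) :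
    spectralRadius ℝ A ≤ ENNReal.ofReal r := by
  refine iSup₂_le fun t ht => ?_
  rw [← Matrix.spectrum_toLin', ← Module.End.hasEigenvalue_iff_mem_spectrum] at ht
  obtain ⟨v, hv⟩ := ht.exists_hasEigenvector
  have hmv : A.mulVec v = t • v := by simpa using hv.apply_eq_smul
  have hpos : 0 < v ⬝ᵥ v := by
    have h1 : 0 ≤ v ⬝ᵥ v := sum_nonneg fun i _ => mul_self_nonneg (v i)
    exact h1.lt_of_ne fun h2 => hv.2 (dotProduct_self_eq_zero.1 h2.symm)
  have habs : (fun i => |v i|) ⬝ᵥ (fun i => |v i|) = v ⬝ᵥ v :=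
    sum_congr rfl fun i _ => abs_mul_abs_self _
  -- Passing from an eigenvector to its absolute values does not lower the modulus of the form, the
  -- entries of `A` being nonnegative.
  have h1 : |t| * (v ⬝ᵥ v) ≤ r * (v ⬝ᵥ v) := by
    calc |t| * (v ⬝ᵥ v) = |v ⬝ᵥ A.mulVec v| := by
          rw [hmv, dotProduct_smul, smul_eq_mul, abs_mul, abs_of_pos hpos]
      _ ≤ (fun i => |v i|) ⬝ᵥ A.mulVec (fun i => |v i|) := by
          simp only [dotProduct, Matrix.mulVec]
          refine (abs_sum_le_sum_abs _ _).trans (sum_le_sum fun i _ => ?_)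
          rw [abs_mul]
          refine mul_le_mul_of_nonneg_left ?_ (abs_nonneg _)
          refine (abs_sum_le_sum_abs _ _).trans (sum_le_sum fun j _ => ?_)
          rw [abs_mul, abs_of_nonneg (hA i j)]
      _ ≤ r * (v ⬝ᵥ v) := habs ▸ h _ fun i => abs_nonneg _
  have h2 : |t| ≤ r := le_of_mul_le_mul_right h1 hpos
  change ‖t‖ₑ ≤ _
  rw [← ofReal_norm]
  exact ENNReal.ofReal_le_ofReal h2

theorem Matrix.spectralRadius_ne_top {n : ℕ} (A : Matrix (Fin n) (Fin n) ℝ) :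
    spectralRadius ℝ A ≠ ⊤ := by
  have hfin := Matrix.finite_spectrum A
  rw [spectralRadius, ← hfin.coe_toFinset]
  refine ((Finset.sup_eq_iSup hfin.toFinset fun k => (‖k‖₊ : ENNReal)).symm.trans_lt ?_).ne
  rw [Finset.sup_lt_iff (by simp)]
  exact fun k _ => ENNReal.coe_lt_top

/-! ### Abel summation -/

/-- Abel summation: weights with nonnegative prefix sums have a nonnegative scalar product with a
nonincreasing nonnegative sequence. -/
theorem sum_range_mul_nonneg_of_prefix {X w : ℕ → ℝ} (hX : Antitone X) {n : ℕ}
    (hX0 : 0 ≤ X n) (hw : ∀ k ≤ n, 0 ≤ ∑ i ∈ range k, w i) :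
    0 ≤ ∑ i ∈ range n, X i * w i := by
  -- Carrying the factor `X m` makes the induction close: lowering it to `X (m + 1)` is harmless
  -- because the prefix sums are nonnegative.
  have key : ∀ m ≤ n, X m * ∑ i ∈ range m, w i ≤ ∑ i ∈ range m, X i * w i := by
    intro m
    induction m with
    | zero => simp
    | succ m ih =>
      intro hm
      have h1 := mul_le_mul_of_nonneg_right (hX (Nat.le_succ m)) (hw (m + 1) hm)
      have h2 := ih (by omega)
      rw [sum_range_succ] at h1 ⊢
      rw [sum_range_succ]
      nlinarith
  exact (mul_nonneg hX0 (hw n le_rfl)).trans (key n le_rfl)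

theorem sum_filter_lt_eq_sum_range {M : Type*} [AddCommMonoid M] {n k : ℕ} (hk : k ≤ n)
    (f : ℕ → M) : ∑ i : Fin n with i.val < k, f i = ∑ i ∈ range k, f i := by
  rw [sum_filter, Fin.sum_univ_eq_sum_range (fun i => if i < k then f i else 0) n, ← sum_filter]
  congr 1
  ext i
  simp
  omega

theorem sum_mul_le_of_prefix {n : ℕ} {x : Fin n → ℝ} (hx : Antitone x) (hx0 : ∀ i, 0 ≤ x i)
    {a b : Fin n → ℝ}
    (hab : ∀ k ≤ n, ∑ i with i.val < k, a i ≤ ∑ i with i.val < k, b i) :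
    ∑ i, x i * a i ≤ ∑ i, x i * b i := by
  -- Extension by zero stays antitone because `x` is nonnegative.
  let X : ℕ → ℝ := fun i => if h : i < n then x ⟨i, h⟩ else 0
  let w : ℕ → ℝ := fun i => if h : i < n then b ⟨i, h⟩ - a ⟨i, h⟩ else 0
  have hX : Antitone X := by
    intro i j hij
    simp only [X]
    split_ifs with h1 h2
    · exact hx (by simpa using hij)
    · omega
    · exact hx0 _
    · exact le_rfl
  have h := sum_range_mul_nonneg_of_prefix (w := w) hX (n := n) (by simp [X]) fun k hk => by
    rw [← sum_filter_lt_eq_sum_range hk]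
    have := hab k hk
    rw [← sub_nonneg, ← sum_sub_distrib] at this
    simpa [w] using this
  rw [← Fin.sum_univ_eq_sum_range (fun i => X i * w i)] at h
  simp only [X, w, Fin.is_lt, dite_true, mul_sub, sum_sub_distrib] at h
  linarith

/-- Abel summation in both variables of a bilinear form. -/
theorem bilinForm_le_of_prefix {n : ℕ} {x : Fin n → ℝ} (hx : Antitone x) (hx0 : ∀ i, 0 ≤ x i)
    {M N : Fin n → Fin n → ℝ}
    (h : ∀ k ≤ n, ∀ l ≤ n, ∑ i with i.val < k, ∑ j with j.val < l, M i j ≤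
      ∑ i with i.val < k, ∑ j with j.val < l, N i j) :
    ∑ i, x i * ∑ j, x j * M i j ≤ ∑ i, x i * ∑ j, x j * N i j := by
  refine sum_mul_le_of_prefix hx hx0 fun k hk => ?_
  rw [sum_comm, sum_comm (s := univ.filter _)]
  simp only [← mul_sum]
  refine sum_mul_le_of_prefix hx hx0 fun l hl => ?_
  rw [sum_comm, sum_comm (s := univ.filter fun j : Fin n => j.val < l)]
  exact h k hk l hl

/-! ### Connected graphs with as many edges as vertices -/

namespace SimpleGraph

variable {V : Type*} {G : SimpleGraph V}

/-- A cycle is determined, as a subgraph, by its set of edges. -/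
theorem Walk.IsCycle.toSubgraph_eq_of_edgeSet {u v : V} {p : G.Walk u u} {q : G.Walk v v}
    (hp : p.IsCycle) (hq : q.IsCycle) (h : ∀ e, e ∈ p.edges ↔ e ∈ q.edges) :
    p.toSubgraph = q.toSubgraph := by
  have hle : ∀ {a b : V} {r : G.Walk a a} {s : G.Walk b b}, r.IsCycle →
      (∀ e, e ∈ r.edges → e ∈ s.edges) → r.toSubgraph ≤ s.toSubgraph := by
    intro a b r s hr hrs
    rw [Walk.toSubgraph_le_iff hr.not_nil]
    intro e he
    rw [Walk.edgeSet_toSubgraph]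
    exact hrs e he
  exact le_antisymm (hle hp fun e => (h e).1) (hle hq fun e => (h e).2)

/-- A connected graph with as many edges as vertices has, for every edge of a cycle, no cycle that
avoids this edge. -/
theorem Connected.mem_edges_of_isCycle [Finite V] (hG : G.Connected)
    (hcard : Nat.card G.edgeSet = Nat.card V) {u v : V} {p : G.Walk u u} {q : G.Walk v v}
    (hp : p.IsCycle) (hq : q.IsCycle) {e : Sym2 V} (he : e ∈ p.edges) : e ∈ q.edges := by
  classical
  by_contra hne
  have heG := p.edges_subset_edgeSet he
  induction e with | h a b =>
  -- An edge of a cycle is no bridge, so deleting it leaves a tree, in which a cycle avoiding the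
  -- edge cannot survive.
  have hbr : ¬ G.IsBridge s(a, b) := fun hb => hb.notMem_edges_of_isCycle hp he
  have hconn := hG.connected_delete_edge_of_not_isBridge hbr
  have htree : (G.deleteEdges {s(a, b)}).IsTree := by
    rw [isTree_iff_connected_and_card]
    refine ⟨hconn, ?_⟩
    rw [edgeSet_deleteEdges, ← hcard]
    exact Set.ncard_sdiff_singleton_add_one heG (Set.toFinite _)
  exact htree.2 _ (hq.toDeleteEdges G {s(a, b)} fun e' he' h => hne (h ▸ he'))

theorem Connected.isUnicyclic_of_card_edgeSet [Finite V] (hG : G.Connected)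
    (hcard : Nat.card G.edgeSet = Nat.card V) : IsUnicyclic G := by
  have hcyc : ¬ G.IsAcyclic := fun h => by
    have := (isTree_iff_connected_and_card.1 (⟨hG, h⟩)).2
    omega
  simp only [IsAcyclic, not_forall, not_not] at hcyc
  obtain ⟨v, p, hp⟩ := hcyc
  refine ⟨hG, p.toSubgraph, ⟨v, p, hp, rfl⟩, ?_⟩
  rintro _ ⟨w, q, hq, rfl⟩
  exact hq.toSubgraph_eq_of_edgeSet hp fun e =>
    ⟨hG.mem_edges_of_isCycle hcard hq hp, hG.mem_edges_of_isCycle hcard hp hq⟩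

theorem Connected.isUnicyclic_of_sum_degrees [Fintype V] [DecidableRel G.Adj] (hG : G.Connected)
    (hsum : ∑ v, G.degree v = 2 * Fintype.card V) : IsUnicyclic G := by
  classical
  refine hG.isUnicyclic_of_card_edgeSet ?_
  have := G.sum_degrees_eq_twice_card_edges
  rw [Nat.card_eq_fintype_card, Nat.card_eq_fintype_card, ← edgeFinset_card]
  omega

/-- In a connected graph with as many edges as vertices, no nonempty set of vertices spans more
edges than it has elements. -/
theorem Connected.sum_adj_le [Fintype V] [DecidableRel G.Adj] (hG : G.Connected)
    (hsum : ∑ v, G.degree v = 2 * Fintype.card V) (s : Finset V) (hs : s.Nonempty) :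
    ∑ u ∈ s, ∑ v ∈ s, (if G.Adj u v then 1 else 0) ≤ 2 * #s := by
  classical
  -- Adding a vertex across the boundary of `s` adds at least one edge, so the excess of edges over
  -- vertices does not drop as `s` grows; for the whole vertex set it is zero.
  induction hk : Fintype.card V - #s generalizing s with
  | zero =>
    have : s = univ := by
      rw [← card_eq_iff_eq_univ]
      have := card_le_univ s
      omega
    subst this
    simp only [sum_boole, ← neighborFinset_eq_filter, card_neighborFinset_eq_degree, Nat.cast_id]
    rw [hsum, card_univ]
  | succ k ih =>
    obtain ⟨a, ha⟩ := hs
    obtain ⟨b, hb⟩ : ∃ b, b ∉ s := by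
      by_contra! h
      rw [(eq_univ_iff_forall.2 h), card_univ] at hk
      omega
    obtain ⟨p⟩ := hG.preconnected a b
    obtain ⟨e, -, h1, h2⟩ := p.exists_boundary_dart (s : Set V) ha hb
    have h2' : e.snd ∉ s := h2
    have h1' : e.fst ∈ s := h1
    have hi := ih (insert e.snd s) (insert_nonempty _ _) (by
      rw [card_insert_of_notMem h2']; omega)
    rw [card_insert_of_notMem h2', sum_insert h2', sum_insert h2'] at hi
    simp only [sum_insert h2', sum_add_distrib] at hi
    have h3 : 1 ≤ ∑ v ∈ s, (if G.Adj e.snd v then 1 else 0) := by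
      refine le_trans ?_ (single_le_sum (fun _ _ => Nat.zero_le _) h1')
      rw [if_pos e.adj.symm]
    have h4 : 1 ≤ ∑ v ∈ s, (if G.Adj v e.snd then 1 else 0) := by
      refine le_trans ?_ (single_le_sum (fun _ _ => Nat.zero_le _) h1')
      rw [if_pos e.adj]
    omega

end SimpleGraph

/-! ### Adjacent pairs between two prefixes -/

/-- The number of pairs `(i, j)` of adjacent vertices with `i < k` and `j < l`. -/
def prefixPairs {n : ℕ} (G : SimpleGraph (Fin n)) [DecidableRel G.Adj] (k l : ℕ) : ℕ :=
  ∑ i : Fin n with i.val < k, ∑ j : Fin n with j.val < l, if G.Adj i j then 1 else 0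

section

variable {n : ℕ} (G : SimpleGraph (Fin n)) [DecidableRel G.Adj]

theorem card_filter_val_lt {k : ℕ} (hk : k ≤ n) : #{i : Fin n | i.val < k} = k := by
  have := sum_filter_lt_eq_sum_range hk fun _ => 1
  simpa using this

theorem prefixPairs_comm (k l : ℕ) : prefixPairs G k l = prefixPairs G l k := by
  unfold prefixPairs
  rw [sum_comm]
  simp only [G.adj_comm]

theorem prefixPairs_le_sum_degrees (k l : ℕ) :
    prefixPairs G k l ≤ ∑ i : Fin n with i.val < k, G.degree i := by
  refine sum_le_sum fun i _ => ?_
  rw [← SimpleGraph.card_neighborFinset_eq_degree, SimpleGraph.neighborFinset_eq_filter,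
    card_filter]
  exact sum_le_sum_of_subset (filter_subset _ _)

/-- Comparison with the pairs inside the two prefixes. -/
theorem two_mul_prefixPairs_le {k l : ℕ} (hkl : k ≤ l) :
    2 * prefixPairs G k l ≤ prefixPairs G k k + prefixPairs G l l := by
  -- The difference of the two sides counts the adjacent pairs with both members in [k, l);
  -- splitting the prefix of length l at k isolates them.
  have hsplit : ∀ f : Fin n → ℕ, ∑ i with i.val < l, f i =
      ∑ i with i.val < k, f i + ∑ i with k ≤ i.val ∧ i.val < l, f i := by
    intro f
    rw [← sum_filter_add_sum_filter_not (univ.filter fun i : Fin n => i.val < l)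
      (fun i => i.val < k), filter_filter, filter_filter]
    congr 2
    · ext i; simp; omega
    · ext i; simp; omega
  have h1 : prefixPairs G k l = prefixPairs G k k +
      ∑ i : Fin n with i.val < k, ∑ j : Fin n with k ≤ j.val ∧ j.val < l,
        if G.Adj i j then 1 else 0 := by
    unfold prefixPairs
    rw [← sum_add_distrib]
    exact sum_congr rfl fun i _ => hsplit _
  have h2 : prefixPairs G k l ≤ prefixPairs G l l - ∑ i : Fin n with k ≤ i.val ∧ i.val < l,
      ∑ j : Fin n with j.val < l, if G.Adj i j then 1 else 0 := by
    unfold prefixPairs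
    rw [hsplit (fun i => ∑ j : Fin n with j.val < l, if G.Adj i j then 1 else 0)]
    omega
  have h3 : ∑ i : Fin n with i.val < k, ∑ j : Fin n with k ≤ j.val ∧ j.val < l,
        (if G.Adj i j then 1 else 0) ≤ ∑ i : Fin n with k ≤ i.val ∧ i.val < l,
      ∑ j : Fin n with j.val < l, if G.Adj i j then 1 else 0 := by
    rw [sum_comm]
    refine sum_le_sum fun i _ => ?_
    simp only [G.adj_comm _ i]
    refine sum_le_sum_of_subset fun j hj => ?_
    simp at hj ⊢
    omega
  have h4 : prefixPairs G k k ≤ prefixPairs G k l := by omega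
  have h5 : ∑ i : Fin n with k ≤ i.val ∧ i.val < l,
      ∑ j : Fin n with j.val < l, (if G.Adj i j then 1 else 0) ≤ prefixPairs G l l := by
    unfold prefixPairs
    exact sum_le_sum_of_subset fun j hj => by simp at hj ⊢; omega
  omega

/-- A vertex is not adjacent to itself, so a prefix has at most `k (k - 1)` adjacent pairs, and a
vertex below `l` at most `l - 1` neighbours below `l`. -/
theorem prefixPairs_le_mul {k l : ℕ} (hkl : k ≤ l) (hl : l ≤ n) :
    prefixPairs G k l ≤ k * (l - 1) := by
  have h : ∀ i ∈ univ.filter fun i : Fin n => i.val < k,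
      (∑ j : Fin n with j.val < l, if G.Adj i j then 1 else 0) ≤ l - 1 := by
    intro i hi
    have hi' : i.val < k := by simpa using hi
    have hmem : i ∈ univ.filter fun j : Fin n => j.val < l := by simp; omega
    rw [← add_sum_erase _ _ hmem, if_neg (G.irrefl), zero_add]
    refine (sum_le_card_nsmul _ _ 1 fun j _ => by split_ifs <;> simp).trans ?_
    rw [card_erase_of_mem hmem, card_filter_val_lt hl, smul_eq_mul, mul_one]
  refine (sum_le_card_nsmul _ _ _ h).trans ?_
  rw [card_filter_val_lt (hkl.trans hl), smul_eq_mul]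

/-- The bound for the number of adjacent pairs between two prefixes of a connected graph with as
many edges as vertices. -/
theorem prefixPairs_le_of_connected {G : SimpleGraph (Fin n)} [DecidableRel G.Adj]
    (hG : G.Connected) (hsum : ∑ i, G.degree i = 2 * n) {k l : ℕ} (hk : 1 ≤ k) (hkl : k ≤ l)
    (hl : l ≤ n) :
    prefixPairs G k l ≤
      (l - 1) + (k - 1) + (if 2 ≤ k ∧ 3 ≤ l then 1 else 0) + (if 3 ≤ k then 1 else 0) := by
  have hpp : ∀ m, 1 ≤ m → m ≤ n → prefixPairs G m m ≤ 2 * m := by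
    intro m hm hmn
    have := hG.sum_adj_le (by simpa using hsum) (univ.filter fun i : Fin n => i.val < m)
      ⟨⟨0, by omega⟩, by simp; omega⟩
    rwa [card_filter_val_lt hmn] at this
  have h1 := two_mul_prefixPairs_le G hkl
  have h2 := prefixPairs_le_mul G hkl hl
  have h3 := hpp l (by omega) hl
  have h4 := hpp k hk (by omega)
  have h5 := prefixPairs_le_mul G (le_refl k) (hkl.trans hl)
  -- For k ≥ 3 the bound is k + l, half of 2k + 2l. For k = 1, and for k = l = 2, the product bound
  -- is sharper; for k = 2 < l the first two vertices span at most one edge.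
  obtain rfl | rfl | hk3 : k = 1 ∨ k = 2 ∨ 3 ≤ k := by omega
  · simp; omega
  · split_ifs <;> omega
  · split_ifs <;> omega

end

/-! ### The breadth-first graph -/

theorem sum_range_indicator_pair (k l a b : ℕ) :
    ∑ i ∈ range k, ∑ j ∈ range l, (if i = a ∧ j = b then 1 else 0) =
      if a < k ∧ b < l then 1 else 0 := by
  have : ∀ i j : ℕ, (if i = a ∧ j = b then 1 else 0) =
      (if i = a then 1 else 0) * (if j = b then 1 else 0) := fun i j => by
    split_ifs <;> simp_all
  simp only [this, ← sum_mul_sum, sum_ite_eq', mem_range]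
  split_ifs <;> simp_all

section

variable {n : ℕ} (d : Fin n → ℕ)

/-- The number of children that the vertices below `i` have together in the breadth-first
construction. -/
def childrenBefore (i : ℕ) : ℕ :=
  ∑ k : Fin n with k.val < i, bfsChildren d k

theorem sum_Iio_bfsChildren (i : Fin n) :
    ∑ k ∈ Iio i, bfsChildren d k = childrenBefore d i.val := by
  unfold childrenBefore
  congr 1
  ext k
  simp only [mem_Iio, mem_filter, mem_univ, true_and, Fin.lt_def]

theorem sum_filter_lt_succ {M : Type*} [AddCommMonoid M] (f : Fin n → M) (i : Fin n) :
    ∑ k : Fin n with k.val < i.val + 1, f k = ∑ k : Fin n with k.val < i.val, f k + f i := by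
  have : univ.filter (fun k : Fin n => k.val < i.val + 1) =
      insert i (univ.filter fun k : Fin n => k.val < i.val) := by
    ext k
    simp [Fin.ext_iff]
    omega
  rw [this, sum_insert (by simp), add_comm]

theorem childrenBefore_succ (i : Fin n) :
    childrenBefore d (i.val + 1) = childrenBefore d i.val + bfsChildren d i :=
  sum_filter_lt_succ _ i

theorem childrenBefore_zero : childrenBefore d 0 = 0 := by simp [childrenBefore]

theorem childrenBefore_mono : Monotone (childrenBefore d) := fun i j hij =>
  sum_le_sum_of_subset fun k hk => by simp at hk ⊢; omega

/-- The vertex `j` is a child of the vertex `i` in the breadth-first construction. -/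
def IsBfsChild (i j : ℕ) : Prop :=
  childrenBefore d i < j ∧ j ≤ childrenBefore d (i + 1)

instance (i j : ℕ) : Decidable (IsBfsChild d i j) :=
  inferInstanceAs (Decidable (_ ∧ _))

theorem bfsUnicyclic_adj {i j : Fin n} : (bfsUnicyclic d).Adj i j ↔ i ≠ j ∧
    ((IsBfsChild d i j ∨ (i.val = 1 ∧ j.val = 2)) ∨
      (IsBfsChild d j i ∨ (j.val = 1 ∧ i.val = 2))) := by
  unfold bfsUnicyclic IsBfsChild
  rw [SimpleGraph.fromRel_adj]
  simp only [sum_Iio_bfsChildren, childrenBefore_succ]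

/-- The number of parents of `j` below `k`. -/
theorem sum_isBfsChild_left (k j : ℕ) :
    ∑ i ∈ range k, (if IsBfsChild d i j then 1 else 0) =
      if 0 < j ∧ j ≤ childrenBefore d k then 1 else 0 := by
  induction k with
  | zero =>
    rw [childrenBefore_zero]
    simp
    omega
  | succ k ih =>
    have := childrenBefore_mono d (Nat.le_succ k)
    rw [sum_range_succ, ih]
    unfold IsBfsChild
    split_ifs <;> grind

/-- The number of children of `i` below `l`, if all its children lie there. -/
theorem sum_isBfsChild_right {i l : ℕ} (h : childrenBefore d (i + 1) < l) :
    ∑ j ∈ range l, (if IsBfsChild d i j then 1 else 0) =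
      childrenBefore d (i + 1) - childrenBefore d i := by
  rw [← card_filter]
  have : (range l).filter (IsBfsChild d i) =
      Ioc (childrenBefore d i) (childrenBefore d (i + 1)) := by
    ext j
    simp [IsBfsChild]
    omega
  rw [this, Nat.card_Ioc]

/-- The partial sums of the numbers of children in terms of those of the degrees. -/
theorem childrenBefore_add (hn : 3 ≤ n) (hpos : ∀ i, 0 < d i) (hanti : Antitone d)
    (h2 : 2 ≤ d ⟨2, by omega⟩) {m : ℕ} (h1 : 1 ≤ m) (hm : m ≤ n) :
    childrenBefore d m + (m - 1) + (if 2 ≤ m then 1 else 0) + (if 3 ≤ m then 1 else 0) =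
      ∑ i : Fin n with i.val < m, d i := by
  induction m, h1 using Nat.le_induction with
  | base =>
    have e1 := childrenBefore_succ d ⟨0, by omega⟩
    have e2 := sum_filter_lt_succ d ⟨0, by omega⟩
    simp [childrenBefore_zero, bfsChildren] at e1 e2 ⊢
    omega
  | succ m h1 ih =>
    have ih := ih (by omega)
    have e1 := childrenBefore_succ d ⟨m, by omega⟩
    have e2 := sum_filter_lt_succ d ⟨m, by omega⟩
    have p := hpos ⟨m, by omega⟩
    -- The subtractions in `bfsChildren` do not truncate: each vertex but the root spends one unit
    -- of degree on its parent, and 1 and 2 spend another on their common edge.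
    have q : m ≤ 2 → 2 ≤ d ⟨m, by omega⟩ := fun h => h2.trans (hanti (by simpa using h))
    simp only [bfsChildren] at e1 e2
    rw [e1, e2, ← ih]
    split_ifs <;> omega

variable (hn : 3 ≤ n) (hpos : ∀ i, 0 < d i) (hanti : Antitone d) (hsum : ∑ i, d i = 2 * n)
  (h2 : 2 ≤ d ⟨2, by omega⟩) (h0 : 3 ≤ d ⟨0, by omega⟩)

include hanti hsum h0 in
/-- A proper prefix of the degree sequence has average larger than two. -/
theorem two_mul_lt_sum_prefix {m : ℕ} (h1 : 1 ≤ m) (hm : m < n) :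
    2 * m < ∑ i : Fin n with i.val < m, d i := by
  -- Either the whole prefix has degrees at least 2, with d_0 ≥ 3, or the remaining n - m degrees
  -- are at most 1 and leave at least n + m for the prefix.
  by_cases h : 2 ≤ d ⟨m, hm⟩
  · have h0m : (⟨0, by omega⟩ : Fin n) ∈ univ.filter fun i : Fin n => i.val < m := by simp; omega
    rw [← add_sum_erase _ _ h0m]
    have h3 : #((univ.filter fun i : Fin n => i.val < m).erase ⟨0, by omega⟩) • 2 ≤
        ∑ i ∈ (univ.filter fun i : Fin n => i.val < m).erase ⟨0, by omega⟩, d i :=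
      card_nsmul_le_sum _ _ _ fun i hi => h.trans (hanti (by
        simp at hi
        exact hi.2.le))
    rw [card_erase_of_mem h0m, card_filter_val_lt hm.le, smul_eq_mul] at h3
    omega
  · have h3 := sum_filter_add_sum_filter_not univ (fun i : Fin n => i.val < m) d
    have h4 : ∑ i : Fin n with ¬ i.val < m, d i ≤ #{i : Fin n | ¬ i.val < m} • 1 :=
      sum_le_card_nsmul _ _ _ fun i hi => by
        have : d i ≤ d ⟨m, hm⟩ := hanti (by simp at hi; exact hi)
        omega
    have h5 := card_filter_add_card_filter_not (s := univ) (fun i : Fin n => i.val < m)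
    rw [card_filter_val_lt hm.le, card_univ, Fintype.card_fin] at h5
    rw [smul_eq_mul] at h4
    omega

include hn hpos hanti hsum h2 in
theorem childrenBefore_self : childrenBefore d n = n - 1 := by
  have := childrenBefore_add d hn hpos hanti h2 (by omega) le_rfl
  rw [if_pos (by omega), if_pos (by omega)] at this
  simp only [Fin.is_lt, filter_true, hsum] at this
  omega

include hn in
theorem childrenBefore_one : childrenBefore d 1 = d ⟨0, by omega⟩ := by
  have := childrenBefore_succ d ⟨0, by omega⟩
  simpa [childrenBefore_zero, bfsChildren] using this

include hn hpos hanti hsum h2 h0 in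
-- The construction never runs dry: when vertex m has its turn, it has already been placed. This
-- follows from the prefix average exceeding two.
theorem le_childrenBefore {m : ℕ} (h1 : 1 ≤ m) (hm : m < n) : m ≤ childrenBefore d m := by
  have e1 := childrenBefore_add d hn hpos hanti h2 h1 hm.le
  have e2 := two_mul_lt_sum_prefix d hn hanti hsum h0 h1 hm
  split_ifs at e1 <;> omega

include hn hpos hanti hsum h2 h0 in
theorem IsBfsChild.lt {i j : ℕ} (hi : i < n) (h : IsBfsChild d i j) : i < j := by
  obtain rfl | hi0 := Nat.eq_zero_or_pos i
  · have := h.1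
    omega
  · exact (le_childrenBefore d hn hpos hanti hsum h2 h0 hi0 hi).trans_lt h.1

/-- The adjacency of the breadth-first graph as a sum of indicators of disjoint relations. -/
def bfsIndicator (i j : ℕ) : ℕ :=
  (if IsBfsChild d i j then 1 else 0) + (if IsBfsChild d j i then 1 else 0) +
    (if i = 1 ∧ j = 2 then 1 else 0) + (if i = 2 ∧ j = 1 then 1 else 0)

include hn hpos hanti hsum h2 h0 in
theorem indicator_bfsUnicyclic_adj [DecidableRel (bfsUnicyclic d).Adj] (i j : Fin n) :
    (if (bfsUnicyclic d).Adj i j then 1 else 0) = bfsIndicator d i j := by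
  have a1 : IsBfsChild d i j → i.val < j.val :=
    IsBfsChild.lt d hn hpos hanti hsum h2 h0 i.2
  have a2 : IsBfsChild d j i → j.val < i.val :=
    IsBfsChild.lt d hn hpos hanti hsum h2 h0 j.2
  -- The children of 1 come after the d_0 ≥ 3 children of the root, so the edge between 1 and 2 is
  -- not counted twice.
  have a3 : ¬ IsBfsChild d 1 2 := fun h => by
    have := h.1
    rw [childrenBefore_one d hn] at this
    omega
  have a4 : ¬ IsBfsChild d 2 1 := fun h => by
    have := h.lt d hn hpos hanti hsum h2 h0 (by omega)
    omega
  have hne : i ≠ j ↔ i.val ≠ j.val := by rw [Ne, Fin.ext_iff]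
  simp only [bfsUnicyclic_adj, hne]
  unfold bfsIndicator
  generalize i.val = a at *
  generalize j.val = b at *
  by_cases h12 : a = 1 ∧ b = 2
  · obtain ⟨rfl, rfl⟩ := h12
    simp [a3, a4]
  by_cases h21 : a = 2 ∧ b = 1
  · obtain ⟨rfl, rfl⟩ := h21
    simp [a3, a4]
  by_cases h : IsBfsChild d a b <;> by_cases h' : IsBfsChild d b a <;>
    simp [h, h', h12, h21, and_comm] <;> grind

include hn hpos hanti hsum h2 h0 in
/-- A vertex all of whose children lie below `l` has all its neighbours there. -/
theorem sum_bfsIndicator {l : ℕ} {i : Fin n} (hl : 3 ≤ l) (h : childrenBefore d (i + 1) < l)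
    (hil : i.val < l) :
    ∑ j ∈ range l, bfsIndicator d i j = d i := by
  unfold bfsIndicator
  simp only [sum_add_distrib]
  rw [sum_isBfsChild_right d h, sum_isBfsChild_left, childrenBefore_succ]
  have e1 : ∑ j ∈ range l, (if i.val = 1 ∧ j = 2 then 1 else 0) = if i.val = 1 then 1 else 0 := by
    simp only [ite_and]
    split_ifs <;> simp; omega
  have e2 : ∑ j ∈ range l, (if i.val = 2 ∧ j = 1 then 1 else 0) = if i.val = 2 then 1 else 0 := by
    simp only [ite_and]
    split_ifs <;> simp; omega
  -- The parent of `i` lies below `l` too.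
  have e3 : i.val ≤ childrenBefore d l := by
    obtain h1 | h1 := Nat.eq_zero_or_pos i.val
    · omega
    · exact (le_childrenBefore d hn hpos hanti hsum h2 h0 h1 i.2).trans
        (childrenBefore_mono d hil.le)
  have q : i.val ≤ 2 → 2 ≤ d i := fun h => h2.trans (hanti (Fin.le_def.2 h))
  have p := hpos i
  rw [e1, e2]
  unfold bfsChildren
  split_ifs <;> grind

include hn hpos hanti hsum h2 h0 in
theorem bfsUnicyclic_degree [DecidableRel (bfsUnicyclic d).Adj] (i : Fin n) :
    (bfsUnicyclic d).degree i = d i := by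
  rw [← SimpleGraph.card_neighborFinset_eq_degree, SimpleGraph.neighborFinset_eq_filter,
    card_filter]
  simp only [indicator_bfsUnicyclic_adj d hn hpos hanti hsum h2 h0]
  rw [Fin.sum_univ_eq_sum_range (bfsIndicator d i)]
  have h3 := childrenBefore_self d hn hpos hanti hsum h2
  have h4 := childrenBefore_mono d (show i.val + 1 ≤ n by omega)
  exact sum_bfsIndicator d hn hpos hanti hsum h2 h0 hn (by omega) i.2

include hn hpos hanti hsum h2 h0 in
theorem bfsUnicyclic_connected : (bfsUnicyclic d).Connected := by
  have hreach : ∀ m (hm : m < n), (bfsUnicyclic d).Reachable ⟨0, by omega⟩ ⟨m, hm⟩ := by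
    intro m
    induction m using Nat.strong_induction_on with
    | _ m ih =>
      intro hm
      obtain rfl | hm0 := Nat.eq_zero_or_pos m
      · exact SimpleGraph.Reachable.refl _
      · have h1 := sum_isBfsChild_left d m m
        rw [if_pos ⟨hm0, le_childrenBefore d hn hpos hanti hsum h2 h0 hm0 hm⟩] at h1
        obtain ⟨i, hi, hne⟩ := exists_ne_zero_of_sum_ne_zero (h1.trans_ne one_ne_zero)
        have hi' := mem_range.1 hi
        refine (ih i hi' (by omega)).trans (SimpleGraph.Adj.reachable ?_)
        rw [bfsUnicyclic_adj]
        exact ⟨by simp; omega, Or.inl (Or.inl (by simpa using hne))⟩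
  have : Nonempty (Fin n) := ⟨⟨0, by omega⟩⟩
  exact ⟨fun u v => (hreach u u.2).symm.trans (hreach v v.2)⟩

include hn hpos hanti hsum h2 h0 in
/-- In a prefix either all neighbours are seen or every vertex has its parent there. -/
theorem le_prefixPairs_bfsUnicyclic [DecidableRel (bfsUnicyclic d).Adj] {k l : ℕ} (hk : 1 ≤ k)
    (hkl : k ≤ l) (hl : l ≤ n) :
    min (∑ i : Fin n with i.val < k, d i)
      ((l - 1) + (k - 1) + (if 2 ≤ k ∧ 3 ≤ l then 1 else 0) + (if 3 ≤ k then 1 else 0)) ≤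
      prefixPairs (bfsUnicyclic d) k l := by
  unfold prefixPairs
  simp only [indicator_bfsUnicyclic_adj d hn hpos hanti hsum h2 h0,
    sum_filter_lt_eq_sum_range hl]
  have hT1 := childrenBefore_one d hn
  have hT1k := childrenBefore_mono d hk
  -- If the children of the first k vertices end below l, full degrees are counted. Otherwise each
  -- vertex in 1, …, l - 1 has its parent below k, and the four kinds of pairs are counted exactly.
  by_cases h : childrenBefore d k < l
  · refine (min_le_left _ _).trans (sum_le_sum fun i hi => ?_)
    simp only [mem_filter, mem_univ, true_and] at hi
    have := childrenBefore_mono d (show i.val + 1 ≤ k by omega)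
    rw [sum_bfsIndicator d hn hpos hanti hsum h2 h0 (by omega) (by omega) (by omega)]
  · refine (min_le_right _ _).trans ?_
    rw [sum_filter_lt_eq_sum_range (hkl.trans hl) fun i => ∑ j ∈ range l, bfsIndicator d i j]
    unfold bfsIndicator
    simp only [sum_add_distrib]
    have hone : ∀ {m p : ℕ}, 1 ≤ m → m ≤ p + 1 →
        ∑ j ∈ range m, (if 0 < j ∧ j ≤ p then 1 else 0) = m - 1 := by
      intro m p hm hmp
      rw [← card_filter]
      have : (range m).filter (fun j => 0 < j ∧ j ≤ p) = Ico 1 m := by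
        ext j
        simp
        omega
      rw [this, Nat.card_Ico]
    have s1 : ∑ i ∈ range k, ∑ j ∈ range l, (if IsBfsChild d i j then 1 else 0) = l - 1 := by
      rw [sum_comm]
      simp only [sum_isBfsChild_left]
      exact hone (by omega) (by omega)
    have s2 : ∑ i ∈ range k, ∑ j ∈ range l, (if IsBfsChild d j i then 1 else 0) = k - 1 := by
      simp only [sum_isBfsChild_left]
      have := childrenBefore_mono d hkl
      exact hone hk (by omega)
    have s3 : ∑ i ∈ range k, ∑ j ∈ range l, (if i = 1 ∧ j = 2 then 1 else 0) =
        if 2 ≤ k ∧ 3 ≤ l then 1 else 0 := by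
      rw [sum_range_indicator_pair]
      congr 1
    have s4 : ∑ i ∈ range k, ∑ j ∈ range l, (if i = 2 ∧ j = 1 then 1 else 0) =
        if 3 ≤ k then 1 else 0 := by
      rw [sum_range_indicator_pair]
      split_ifs <;> first | rfl | omega
    rw [s1, s2, s3, s4]

end

/-! ### Necessity of d_2 ≥ 2 and comparison of quadratic forms -/

section

variable {n : ℕ} (d : Fin n → ℕ)

/-- If d_2 ≤ 1, no vertex is adjacent to both vertices of largest degree, so d_0 + d_1 ≤ n; the
other n - 2 degrees are at most 1, and the sum stays below 2n. -/
theorem two_le_of_hasDegreeSequence (hn : 3 ≤ n) (hanti : Antitone d) (hsum : ∑ i, d i = 2 * n)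
    {V : Type*} [Fintype V] {G : SimpleGraph V} (hG : HasDegreeSequence G d) :
    2 ≤ d ⟨2, by omega⟩ := by
  classical
  obtain ⟨e, he⟩ := hG
  by_contra hlt
  set z : Fin n := ⟨0, by omega⟩ with hz
  set o : Fin n := ⟨1, by omega⟩ with ho
  have hzo : o ≠ z := by simp [hz, ho]
  have hdeg : ∀ i, d i = ∑ j, if G.Adj (e i) (e j) then 1 else 0 := fun i => by
    rw [← he i, ← SimpleGraph.card_neighborFinset_eq_degree,
      SimpleGraph.neighborFinset_eq_filter, card_filter,
      ← e.sum_comp fun v => if G.Adj (e i) v then 1 else 0]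
  have hone : ∀ i : Fin n, i ≠ z → i ≠ o → d i ≤ 1 := fun i h0 h1 => by
    have : d i ≤ d ⟨2, by omega⟩ := hanti (by
      rw [Fin.le_def]
      rw [hz, Ne, Fin.ext_iff] at h0
      rw [ho, Ne, Fin.ext_iff] at h1
      simp at h0 h1 ⊢
      omega)
    omega
  have hle : d z + d o ≤ n := by
    rw [hdeg z, hdeg o, ← sum_add_distrib]
    have : ∀ j : Fin n, (if G.Adj (e z) (e j) then 1 else 0) +
        (if G.Adj (e o) (e j) then 1 else 0) ≤ 1 := by
      intro j
      by_cases h0 : j = z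
      · subst h0
        rw [if_neg G.irrefl]
        split_ifs <;> simp
      by_cases h1 : j = o
      · subst h1
        rw [if_neg (G.irrefl (v := e o))]
        split_ifs <;> simp
      · have h2 := hone j h0 h1
        rw [hdeg j, ← add_sum_erase _ _ (mem_univ z),
          ← add_sum_erase _ _ (mem_erase.2 ⟨hzo, mem_univ o⟩)] at h2
        rw [G.adj_comm (e z), G.adj_comm (e o)]
        omega
    simpa using sum_le_sum fun j (_ : j ∈ univ) => this j
  rw [← add_sum_erase _ _ (mem_univ z),
    ← add_sum_erase _ _ (mem_erase.2 ⟨hzo, mem_univ o⟩)] at hsum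
  have h3 := sum_le_card_nsmul ((univ.erase z).erase o) d 1 fun i hi => by
    simp at hi
    exact hone i hi.2 hi.1
  change ∑ i ∈ (univ.erase z).erase o, d i ≤ _ at h3
  rw [card_erase_of_mem (mem_erase.2 ⟨hzo, mem_univ o⟩), card_erase_of_mem (mem_univ z),
    card_univ, Fintype.card_fin, smul_eq_mul] at h3
  omega

theorem degree_comap_equiv {V W : Type*} [Fintype V] [Fintype W] (G : SimpleGraph W)
    (σ : V ≃ W) [DecidableRel G.Adj] [DecidableRel (G.comap σ).Adj] (v : V) :
    (G.comap σ).degree v = G.degree (σ v) := by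
  classical
  rw [← SimpleGraph.card_neighborFinset_eq_degree, ← SimpleGraph.card_neighborFinset_eq_degree,
    SimpleGraph.neighborFinset_eq_filter, SimpleGraph.neighborFinset_eq_filter, card_filter,
    card_filter, ← σ.sum_comp]
  simp

/-- Rearrangement inequality against the indicator of the prefix. -/
theorem sum_comp_perm_prefix_le (hanti : Antitone d) (τ : Equiv.Perm (Fin n)) (k : ℕ) :
    ∑ i with i.val < k, d (τ i) ≤ ∑ i with i.val < k, d i := by
  have h : Antitone fun i : Fin n => if i.val < k then 1 else 0 := fun i j hij => by
    have : i.val ≤ j.val := hij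
    dsimp only
    split_ifs <;> omega
  have := (h.monovary hanti).sum_mul_comp_perm_le_sum_mul (σ := τ)
  simpa [sum_filter] using this

variable (hn : 3 ≤ n) (hpos : ∀ i, 0 < d i) (hanti : Antitone d) (hsum : ∑ i, d i = 2 * n)
  (h2 : 2 ≤ d ⟨2, by omega⟩) (h0 : 3 ≤ d ⟨0, by omega⟩)

include hn hpos hanti hsum h2 h0 in
/-- The breadth-first graph maximizes the quadratic form of `A_α` on nonincreasing nonnegative
vectors. -/
theorem aAlphaMatrix_quadForm_le_of_antitone {α : ℝ} (hα0 : 0 ≤ α) (hα1 : α < 1)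
    {G : SimpleGraph (Fin n)} [DecidableRel G.Adj] (hG : G.Connected) (τ : Equiv.Perm (Fin n))
    (hdeg : ∀ i, G.degree i = d (τ i)) {x : Fin n → ℝ} (hx : Antitone x) (hx0 : ∀ i, 0 ≤ x i) :
    x ⬝ᵥ (aAlphaMatrix α G).mulVec x ≤ x ⬝ᵥ (aAlphaMatrix α (bfsUnicyclic d)).mulVec x := by
  classical
  rw [aAlphaMatrix_quadForm, aAlphaMatrix_quadForm]
  simp only [hdeg, bfsUnicyclic_degree d hn hpos hanti hsum h2 h0]
  refine add_le_add (mul_le_mul_of_nonneg_left ?_ hα0)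
    (mul_le_mul_of_nonneg_left ?_ (by linarith))
  · have hd : Antitone fun i => (d i : ℝ) := fun i j hij => Nat.cast_le.2 (hanti hij)
    have hx2 : Antitone fun i => x i ^ 2 := fun i j hij => pow_le_pow_left₀ (hx0 j) (hx hij) 2
    simpa only [mul_comm] using (hx2.monovary hd).sum_mul_comp_perm_le_sum_mul (σ := τ)
  · have hp : ∀ k l, k ≤ l → l ≤ n → prefixPairs G k l ≤ prefixPairs (bfsUnicyclic d) k l := by
      intro k l hkl hl
      obtain rfl | hk := Nat.eq_zero_or_pos k
      · simp [prefixPairs]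
      refine le_trans (le_min ?_ (prefixPairs_le_of_connected hG ?_ hk hkl hl))
        (le_prefixPairs_bfsUnicyclic d hn hpos hanti hsum h2 h0 hk hkl hl)
      · refine (prefixPairs_le_sum_degrees G k l).trans ?_
        simp only [hdeg]
        exact sum_comp_perm_prefix_le d hanti τ k
      · simp only [hdeg]
        rw [Equiv.sum_comp τ d, hsum]
    refine bilinForm_le_of_prefix hx hx0 fun k hk l hl => ?_
    have : prefixPairs G k l ≤ prefixPairs (bfsUnicyclic d) k l := by
      obtain h | h := le_total k l
      · exact hp k l h hl
      · rw [prefixPairs_comm, prefixPairs_comm (bfsUnicyclic d)]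
        exact hp l k h hk
    unfold prefixPairs at this
    exact_mod_cast this

end

theorem exists_perm_antitone {n : ℕ} (x : Fin n → ℝ) :
    ∃ σ : Equiv.Perm (Fin n), Antitone (x ∘ σ) :=
  ⟨Tuple.sort (-x), fun i j hij => by
    have := Tuple.monotone_sort (-x) hij
    simpa using this⟩

theorem aAlphaMatrix_comap {n : ℕ} (α : ℝ) (G : SimpleGraph (Fin n)) (σ : Equiv.Perm (Fin n)) :
    aAlphaMatrix α (G.comap σ) = (aAlphaMatrix α G).submatrix σ σ := by
  classical
  unfold aAlphaMatrix
  ext i j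
  simp only [Matrix.add_apply, Matrix.smul_apply, smul_eq_mul, SimpleGraph.degMatrix,
    Matrix.diagonal_apply, SimpleGraph.adjMatrix_apply, Matrix.submatrix_apply,
    degree_comap_equiv, SimpleGraph.comap_adj, σ.injective.eq_iff]

theorem quadForm_submatrix {n : ℕ} (A : Matrix (Fin n) (Fin n) ℝ) (σ : Equiv.Perm (Fin n))
    (x : Fin n → ℝ) : (x ∘ σ) ⬝ᵥ (A.submatrix σ σ).mulVec (x ∘ σ) = x ⬝ᵥ A.mulVec x := by
  simp only [dotProduct, Matrix.mulVec, Matrix.submatrix_apply, Function.comp_apply]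
  rw [← Equiv.sum_comp σ fun i => x i * ∑ j, A i j * x j]
  refine sum_congr rfl fun i _ => ?_
  rw [← Equiv.sum_comp σ fun j => A (σ i) j * x j]

/-! ### Comparison of spectral radii and the cases of `uStar` -/

section

variable {n : ℕ} (d : Fin n → ℕ) (hn : 3 ≤ n) (hpos : ∀ i, 0 < d i) (hanti : Antitone d)
  (hsum : ∑ i, d i = 2 * n) (h2 : 2 ≤ d ⟨2, by omega⟩)

include hn hpos hanti hsum h2 in
theorem aAlphaSpectralRadius_le_bfsUnicyclic (h0 : 3 ≤ d ⟨0, by omega⟩) {α : ℝ} (hα0 : 0 ≤ α)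
    (hα1 : α < 1) {G : SimpleGraph (Fin n)} (hG : G ∈ connectedClass d) :
    aAlphaSpectralRadius α G ≤ aAlphaSpectralRadius α (bfsUnicyclic d) := by
  classical
  obtain ⟨hconn, e, he⟩ := hG
  unfold aAlphaSpectralRadius
  have hH := ENNReal.ofReal_toReal
    (Matrix.spectralRadius_ne_top (aAlphaMatrix α (bfsUnicyclic d)))
  rw [← hH]
  refine Matrix.spectralRadius_le_of_quadForm_le (aAlphaMatrix_nonneg hα0 hα1 G) fun x hx => ?_
  -- The sorting permutation depends on `x`, but relabelling `G` by it changes neither the form nor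
  -- the norm, and the bound on the right is the same for all `x`.
  obtain ⟨σ, hσ⟩ := exists_perm_antitone x
  rw [← quadForm_submatrix _ σ, ← aAlphaMatrix_comap]
  have hxx : (x ∘ σ) ⬝ᵥ (x ∘ σ) = x ⬝ᵥ x := Equiv.sum_comp σ fun i => x i * x i
  rw [← hxx]
  refine (aAlphaMatrix_quadForm_le_of_antitone d hn hpos hanti hsum h2 h0 hα0 hα1
    ((SimpleGraph.Iso.comap σ G).connected_iff.2 hconn) (σ.trans e.symm) (fun i => ?_) hσ
    fun i => hx _).trans ((aAlphaMatrix_isHermitian α _).quadForm_le_spectralRadius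
      ENNReal.toReal_nonneg hH.ge _)
  rw [degree_comap_equiv, Equiv.trans_apply, ← he, Equiv.apply_symm_apply]

include hanti hsum in
theorem eq_two_of_apply_zero_eq_two (h0 : d ⟨0, by omega⟩ = 2) (i : Fin n) : d i = 2 := by
  have hle : ∀ j ∈ univ, d j ≤ 2 := fun j _ =>
    h0 ▸ hanti (Fin.le_def.2 (Nat.zero_le j.val))
  refine (sum_eq_sum_iff_of_le hle).1 ?_ i (mem_univ i)
  rw [hsum]
  simp [mul_comm]

/-- The `A_α`-spectral radius of a `2`-regular graph is `2`. -/
theorem aAlphaSpectralRadius_of_degree_eq_two (hn0 : n ≠ 0) {α : ℝ} (hα0 : 0 ≤ α) (hα1 : α < 1)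
    (G : SimpleGraph (Fin n)) [DecidableRel G.Adj] (hG : ∀ i, G.degree i = 2) :
    aAlphaSpectralRadius α G = 2 := by
  have hrow : ∀ i, ∑ j, (if G.Adj i j then (1 : ℝ) else 0) = 2 := fun i => by
    rw [sum_boole, ← SimpleGraph.neighborFinset_eq_filter,
      SimpleGraph.card_neighborFinset_eq_degree, hG, Nat.cast_ofNat]
  apply le_antisymm
  · rw [← ENNReal.ofReal_ofNat]
    refine Matrix.spectralRadius_le_of_quadForm_le (aAlphaMatrix_nonneg hα0 hα1 G) fun x _ => ?_
    -- From 2 x_i x_j ≤ x_i² + x_j² on each edge.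
    have hS : ∑ i, x i * ∑ j, x j * (if G.Adj i j then (1 : ℝ) else 0) ≤ 2 * ∑ i, x i ^ 2 := by
      calc ∑ i, x i * ∑ j, x j * (if G.Adj i j then (1 : ℝ) else 0)
          ≤ ∑ i, ∑ j, (x i ^ 2 / 2 * (if G.Adj i j then (1 : ℝ) else 0) +
              x j ^ 2 / 2 * (if G.Adj i j then (1 : ℝ) else 0)) := by
            refine sum_le_sum fun i _ => ?_
            rw [mul_sum]
            refine sum_le_sum fun j _ => ?_
            split_ifs
            · nlinarith [sq_nonneg (x i - x j)]
            · simp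
        _ = 2 * ∑ i, x i ^ 2 := by
            simp only [sum_add_distrib]
            rw [sum_comm (f := fun i j => x j ^ 2 / 2 * (if G.Adj i j then (1 : ℝ) else 0))]
            simp only [← mul_sum, hrow, G.adj_comm _ (_ : Fin n)]
            simp only [mul_sum, ← sum_add_distrib]
            exact sum_congr rfl fun i _ => by ring
    rw [aAlphaMatrix_quadForm]
    simp only [hG, Nat.cast_ofNat, ← mul_sum]
    have hxx : x ⬝ᵥ x = ∑ i, x i ^ 2 := sum_congr rfl fun i _ => (sq (x i)).symm
    rw [hxx]
    nlinarith [mul_le_mul_of_nonneg_left hS (sub_nonneg.2 hα1.le)]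
  -- The all-ones vector gives the lower bound.
  · have hH := ENNReal.ofReal_toReal (Matrix.spectralRadius_ne_top (aAlphaMatrix α G))
    have h := (aAlphaMatrix_isHermitian α G).quadForm_le_spectralRadius
      ENNReal.toReal_nonneg hH.ge (fun _ => 1)
    rw [aAlphaMatrix_quadForm] at h
    simp only [hG, one_mul, hrow, one_pow, mul_one, dotProduct, sum_const, card_univ,
      Fintype.card_fin, nsmul_eq_mul, Nat.cast_ofNat] at h
    unfold aAlphaSpectralRadius
    rw [← hH, ← ENNReal.ofReal_ofNat]
    refine ENNReal.ofReal_le_ofReal ?_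
    have hnpos : (0 : ℝ) < n := by positivity
    refine le_of_mul_le_mul_right ?_ hnpos
    nlinarith

include hn hpos hanti hsum h2 in
-- With d_1 = 2, vertices 1 and 2 have no children and each later vertex has at most one, so
-- breadth-first numbering deals vertices to the k = d_0 - 2 paths in rotation: the child of m is m
-- + k.
theorem triangleWithPaths_eq_bfsUnicyclic (h0 : 3 ≤ d ⟨0, by omega⟩) (h1 : d ⟨1, by omega⟩ = 2) :
    triangleWithPaths n (d ⟨0, by omega⟩ - 2) = bfsUnicyclic d := by
  set k := d ⟨0, by omega⟩ - 2 with hk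
  have hle : ∀ i : Fin n, i.val ≠ 0 → d i ≤ 2 := fun i hi =>
    h1 ▸ hanti (Fin.le_def.2 (Nat.one_le_iff_ne_zero.2 hi))
  have htwo : ∀ i : Fin n, i.val ≤ 2 → 2 ≤ d i := fun i hi =>
    h2.trans (hanti (Fin.le_def.2 hi))
  have hself := childrenBefore_self d hn hpos hanti hsum h2
  have hbase : childrenBefore d 3 = k + 2 := by
    have e0 := childrenBefore_one d hn
    have e1 := childrenBefore_succ d ⟨1, by omega⟩
    have e2 := childrenBefore_succ d ⟨2, by omega⟩
    have := hle ⟨2, by omega⟩ (by simp)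
    simp [bfsChildren] at e1 e2
    omega
  /- From the vertex `3` on there is one child each until the vertices are used up. -/
  have hT : ∀ m, 3 ≤ m → m ≤ n → childrenBefore d m = min (k + m - 1) (n - 1) := by
    intro m hm
    induction m, hm using Nat.le_induction with
    | base =>
      intro _
      have := childrenBefore_mono d hn
      omega
    | succ m hm ih =>
      intro hmn
      have ih := ih (by omega)
      have hs := childrenBefore_succ d ⟨m, by omega⟩
      have hmono := childrenBefore_mono d hmn
      have hb : bfsChildren d ⟨m, by omega⟩ = d ⟨m, by omega⟩ - 1 := by
        unfold bfsChildren
        rw [if_neg (by simp; omega), if_neg (by simp; omega)]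
      have hd2 := hle ⟨m, by omega⟩ (by simp; omega)
      have hd1 := hpos ⟨m, by omega⟩
      simp only at hs
      obtain hd | hd : d ⟨m, by omega⟩ = 1 ∨ d ⟨m, by omega⟩ = 2 := by omega
      -- Once a degree is 1, so are all later ones and no child is added; as the total is n - 1, it
      -- has been reached already.
      · have hconst : ∀ p, m ≤ p → p ≤ n → childrenBefore d p = childrenBefore d m := by
          intro p hp
          induction p, hp using Nat.le_induction with
          | base => simp
          | succ p hp ihp =>
            intro hpn
            have hs' := childrenBefore_succ d ⟨p, by omega⟩
            have : d ⟨p, by omega⟩ ≤ d ⟨m, by omega⟩ := hanti (Fin.le_def.2 hp)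
            have hb' : bfsChildren d ⟨p, by omega⟩ = d ⟨p, by omega⟩ - 1 := by
              unfold bfsChildren
              rw [if_neg (by simp; omega), if_neg (by simp; omega)]
            have := ihp (by omega)
            simp only at hs'
            omega
        have := hconst n (by omega) le_rfl
        omega
      · omega
  have hrel : ∀ i j : Fin n, j ≠ i →
      (((i.val = 0 ∧ j.val < 3 + k) ∨ (i.val = 1 ∧ j.val = 2) ∨ (3 ≤ i.val ∧ j.val = i.val + k)) ↔
        (IsBfsChild d i j ∨ (i.val = 1 ∧ j.val = 2))) := by
    intro i j hij
    rw [Ne, Fin.ext_iff] at hij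
    have e0 := childrenBefore_zero d
    have e1 := childrenBefore_one d hn
    unfold IsBfsChild
    obtain hi | hi | hi | hi : i.val = 0 ∨ i.val = 1 ∨ i.val = 2 ∨ 3 ≤ i.val := by omega
    · rw [hi, e0, zero_add, e1]
      omega
    · have m1 := childrenBefore_mono d (show 1 + 1 ≤ 3 by omega)
      rw [hi, e1]
      omega
    · have m1 := childrenBefore_mono d (show 1 ≤ 2 by omega)
      rw [hi, hbase]
      omega
    · rw [hT i hi (by omega), hT (i + 1) (by omega) (by omega)]
      omega
  ext i j
  rw [bfsUnicyclic_adj]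
  unfold triangleWithPaths
  rw [SimpleGraph.fromRel_adj]
  refine and_congr_right fun hij => ?_
  rw [hrel i j hij.symm, hrel j i hij]

include hpos hanti hsum h2 in
theorem uStar_eq_bfsUnicyclic (h0 : 3 ≤ d ⟨0, by omega⟩) : uStar hn d = bfsUnicyclic d := by
  unfold uStar
  rw [if_neg (by omega)]
  split_ifs with h1
  · exact triangleWithPaths_eq_bfsUnicyclic d hn hpos hanti hsum h2 h0 h1
  · rfl

theorem cycleGraph_degree_eq_two (hn : 3 ≤ n) [DecidableRel (SimpleGraph.cycleGraph n).Adj]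
    (i : Fin n) : (SimpleGraph.cycleGraph n).degree i = 2 := by
  obtain ⟨m, rfl⟩ := Nat.exists_eq_add_of_le' hn
  convert SimpleGraph.cycleGraph_degree_three_le

include hpos hanti hsum h2 in
theorem uStar_connected_and_degree [DecidableRel (uStar hn d).Adj] :
    (uStar hn d).Connected ∧ ∀ i, (uStar hn d).degree i = d i := by
  classical
  have h02 : d ⟨2, by omega⟩ ≤ d ⟨0, by omega⟩ := hanti (Fin.le_def.2 (Nat.zero_le _))
  obtain h0 | h0 : d ⟨0, by omega⟩ = 2 ∨ 3 ≤ d ⟨0, by omega⟩ := by omega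
  · have hU : uStar hn d = SimpleGraph.cycleGraph n := if_pos h0
    refine ⟨?_, fun i => ?_⟩
    · rw [hU]
      obtain ⟨m, rfl⟩ := Nat.exists_eq_add_of_le' (show 1 ≤ n by omega)
      exact SimpleGraph.cycleGraph_connected
    · rw [eq_two_of_apply_zero_eq_two d hn hanti hsum h0, ← cycleGraph_degree_eq_two hn i]
      congr!
  · have hU := uStar_eq_bfsUnicyclic d hn hpos hanti hsum h2 h0
    refine ⟨hU ▸ bfsUnicyclic_connected d hn hpos hanti hsum h2 h0, fun i => ?_⟩
    rw [← bfsUnicyclic_degree d hn hpos hanti hsum h2 h0 i]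
    congr!

end

theorem theorem1p2 (n : ℕ) (hn : 3 ≤ n) (d : Fin n → ℕ) (hpos : ∀ i, 0 < d i)
    (hanti : Antitone d) (hsum : ∑ i, d i = 2 * n) :
    (IsUnicyclicGraphic d ↔ 2 ≤ d ⟨2, by omega⟩) ∧
    (IsUnicyclicGraphic d →
      (uStar hn d ∈ connectedClass d ∧ IsUnicyclic (uStar hn d)) ∧
      ∀ α : ℝ, 0 ≤ α → α < 1 →
        IsGreatest
          {r : ENNReal | ∃ H : SimpleGraph (Fin n),
            IsUnicyclic H ∧ H ∈ connectedClass d ∧ r = aAlphaSpectralRadius α H}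
          (aAlphaSpectralRadius α (uStar hn d))) := by
  classical
  have hstar : 2 ≤ d ⟨2, by omega⟩ →
      uStar hn d ∈ connectedClass d ∧ IsUnicyclic (uStar hn d) := fun h2 => by
    obtain ⟨hconn, hdeg⟩ := uStar_connected_and_degree d hn hpos hanti hsum h2
    refine ⟨⟨hconn, Equiv.refl _, fun i => ?_⟩, hconn.isUnicyclic_of_sum_degrees ?_⟩
    · rw [← hdeg i]
      rfl
    · simp only [hdeg, hsum, Fintype.card_fin]
  have htwo : IsUnicyclicGraphic d → 2 ≤ d ⟨2, by omega⟩ := fun ⟨G, hG, _⟩ =>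
    two_le_of_hasDegreeSequence d hn hanti hsum hG.2
  refine ⟨⟨htwo, fun h2 => ⟨_, hstar h2⟩⟩, fun hgr => ⟨hstar (htwo hgr), fun α hα0 hα1 => ?_⟩⟩
  have h2 := htwo hgr
  refine ⟨⟨_, (hstar h2).2, (hstar h2).1, rfl⟩, ?_⟩
  rintro _ ⟨H, -, hH, rfl⟩
  have h02 : d ⟨2, by omega⟩ ≤ d ⟨0, by omega⟩ := hanti (Fin.le_def.2 (Nat.zero_le _))
  obtain h0 | h0 : d ⟨0, by omega⟩ = 2 ∨ 3 ≤ d ⟨0, by omega⟩ := by omega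
  · obtain ⟨-, e, he⟩ := hH
    have hd := eq_two_of_apply_zero_eq_two d hn hanti hsum h0
    rw [aAlphaSpectralRadius_of_degree_eq_two (by omega) hα0 hα1 H fun v => by
        obtain ⟨i, rfl⟩ := e.surjective v
        rw [← hd i, ← he i],
      aAlphaSpectralRadius_of_degree_eq_two (by omega) hα0 hα1 (uStar hn d) fun v => by
        rw [(uStar_connected_and_degree d hn hpos hanti hsum h2).2, hd]]
  · rw [uStar_eq_bfsUnicyclic d hn hpos hanti hsum h2 h0]
    exact aAlphaSpectralRadius_le_bfsUnicyclic d hn hpos hanti hsum h2 h0 hα0 hα1 hH
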